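/- Fix an integer $d\ge 0$ and a real number $p$ with $1<p<\infty$. For $z\in\mathbb{C}^d$ write $z^2=z_1^2+\cdots+z_d^2$ (no complex conjugation), and let $\rho(z)=(2\pi)^{-d/2}e^{-z^2/2}$, so that $\rho(x)\,dx$ is the standard Gaussian measure on $\mathbb{R}^d$. Let $L^p(\mathbb{R}^d,\rho)$ denote the space of (almost-everywhere classes of) complex-valued functions that are $p$-integrable with respect to $\rho(x)\,dx$. For $f\in L^p(\mathbb{R}^d,\rho)$ the Segal–Bargmann transform of $f$ is $$Sf(z)=\int_{\mathbb{R}^d}\rho(z-x)\,f(x)\,dx=(2\pi)^{-d/2}\int_{\mathbb{R}^d}e^{-(z-x)^2/2}f(x)\,dx,\qquad z\in\mathbb{C}^d .$$ Suppose that $F:\mathbb{C}^d\to\mathbb{C}$ is an entire holomorphic function such that $$\int_{\mathbb{R}^d}\int_{\mathbb{R}^d}|F(x+iy)|\,e^{-y^2/2}\,e^{-x^2/(2(p-1))}\,dx\,dy<\infty .$$ Then there exists a unique $f\in L^p(\mathbb{R}^d,\rho)$ with $Sf(z)=F(z)$ for all $z\in\mathbb{C}^d$. -/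

import Mathlib

noncomputable section

namespace SegalBargmann

open MeasureTheory

/-- The standard Gaussian density `ρ(x) = (2π)^(-d/2) exp(-x²/2)` on `ℝ^d`,
where `x² = x₁² + ⋯ + x_d²`. -/
def rho {d : ℕ} (x : Fin d → ℝ) : ℝ :=
  (2 * Real.pi) ^ (-(d : ℝ) / 2) * Real.exp (-(∑ j, x j ^ 2) / 2)

/-- The entire continuation of the standard Gaussian density to `ℂ^d`;
here `z² = z₁² + ⋯ + z_d²`, without complex conjugation. -/
def rhoC {d : ℕ} (z : Fin d → ℂ) : ℂ :=
  (((2 * Real.pi) ^ (-(d : ℝ) / 2) : ℝ) : ℂ) * Complex.exp (-(∑ j, z j ^ 2) / 2)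

/-- The continuation agrees with the density on `ℝ^d`. -/
theorem rhoC_ofReal {d : ℕ} (x : Fin d → ℝ) :
    rhoC (fun j => (x j : ℂ)) = ((rho x : ℝ) : ℂ) := by
  simp [rhoC, rho]

/-- The Gaussian measure `ρ(x) dx` on `ℝ^d`. -/
def gaussianMeasure (d : ℕ) : Measure (Fin d → ℝ) :=
  volume.withDensity (fun x => ENNReal.ofReal (rho x))

/-- The Segal-Bargmann transform `Sf(z) = ∫ ρ(z - x) f(x) dx`, `z ∈ ℂ^d`. -/
def transform {d : ℕ} (f : (Fin d → ℝ) → ℂ) (z : Fin d → ℂ) : ℂ :=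
  ∫ x : Fin d → ℝ, rhoC (fun j => z j - (x j : ℂ)) * f x

/-- The point `x + iy` of `ℂ^d`. -/
def toComplex {d : ℕ} (x y : Fin d → ℝ) : Fin d → ℂ :=
  fun j => (x j : ℂ) + Complex.I * (y j : ℂ)

end SegalBargmann

end

/-! Existence: set `a = p / (2(p-1))` and `G(w) = F(w) e^{(1-a)w²/2}`. The hypothesis says exactly
that `|G(w)| e^{-a|w|²/2}` is integrable on `ℂ^d`. This suffices for the Bargmann–Fock reproducing
formula, which writes `G(z)`, up to a constant, as `∫ G(w) e^{a z·w̄} e^{-a|w|²} dw`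
(`reproducing_formula`). Up to the factor `e^{-(1-a)z²/2}` and a constant, each kernel `e^{a z·w̄}`
is the transform of an explicit Gaussian wave packet (`transform_coherent`). Superposing the packets
with amplitude `G(w) e^{-a|w|²}` thus yields a preimage of `F`, up to a constant. It lies in
`L^p(ρ)` by Minkowski's inequality, because for this `a` the packets weighted by `e^{-a|w|²/2}` have
an `L^p(ρ)` norm independent of `w` (`lintegral_norm_coherent_rpow`).

Uniqueness: on `iℝ^d` the transform is, up to a nonvanishing factor, the Fourier transform of the
integrable function `ρ f`. -/

noncomputable section

namespace SegalBargmann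

open MeasureTheory Complex ComplexConjugate

/-! ### Lebesgue measure and radial Gaussians on `ℂ^d` -/

/-- `(x, y) ↦ x + iy` carries Lebesgue measure on `ℝ^d × ℝ^d` to Lebesgue measure on `ℂ^d`. -/
theorem measurePreserving_toComplex (d : ℕ) :
    MeasurePreserving (fun w : (Fin d → ℝ) × (Fin d → ℝ) => toComplex w.1 w.2)
      volume volume := by
  have h1 := (volume_measurePreserving_arrowProdEquivProdArrow ℝ ℝ (Fin d)).symm
  have h2 := volume_preserving_pi
    (fun _ : Fin d => Complex.volume_preserving_equiv_real_prod.symm)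
  have h3 : (fun w : (Fin d → ℝ) × (Fin d → ℝ) => toComplex w.1 w.2) =
      (fun (u : Fin d → ℝ × ℝ) i => Complex.measurableEquivRealProd.symm (u i)) ∘
        (MeasurableEquiv.arrowProdEquivProdArrow ℝ ℝ (Fin d)).symm := by
    funext w j
    have : ((MeasurableEquiv.arrowProdEquivProdArrow ℝ ℝ (Fin d)).symm w) j = (w.1 j, w.2 j) := rfl
    simp only [toComplex, Function.comp, this]
    apply Complex.ext <;> simp
  rw [h3]
  exact h2.comp h1

/-- Multiplication by a unit complex number preserves Lebesgue measure on `ℂ^d`. -/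
theorem measurePreserving_circle_smul {d : ℕ} (c : Circle) :
    MeasurePreserving (fun w : Fin d → ℂ => (c : ℂ) • w) volume volume :=
  volume_preserving_pi (fun _ : Fin d => (rotation c).measurePreserving)

theorem measurableEmbedding_circle_smul {d : ℕ} (c : Circle) :
    MeasurableEmbedding (fun w : Fin d → ℂ => (c : ℂ) • w) :=
  measurableEmbedding_const_smul₀ (by simp)

theorem integrable_exp_neg_mul_sum_norm_sq {d : ℕ} {a : ℝ} (ha : 0 < a) :
    Integrable (fun w : Fin d → ℂ => Real.exp (-a * ∑ j, ‖w j‖ ^ 2)) := by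
  have h1 : Integrable (fun z : ℂ => Real.exp (-a * ‖z‖ ^ 2)) := by
    have := (GaussianFourier.integrable_cexp_neg_mul_sq_norm_add (V := ℂ) (b := a)
      (by simpa using ha) 0 0).norm
    refine this.congr (ae_of_all _ fun z => ?_)
    simp [Complex.norm_exp, ← Complex.ofReal_pow]
  have h2 := Integrable.fintype_prod (f := fun (_ : Fin d) (z : ℂ) => Real.exp (-a * ‖z‖ ^ 2))
    (μ := fun _ => volume) (fun _ => h1)
  refine h2.congr (ae_of_all _ fun w => ?_)
  simp only [← Real.exp_sum, Finset.mul_sum]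

/-! ### Mean value property and reproducing formula -/

/-- An entire function of one variable equals its average over the unit circle. -/
theorem intervalIntegral_circle_eq {h : ℂ → ℂ} (hh : Differentiable ℂ h) :
    ∫ θ in (0 : ℝ)..2 * Real.pi, h (Circle.exp θ) = (2 * Real.pi : ℝ) * h 0 := by
  have h1 := (hh.diffContOnCl (s := Metric.ball 0 |1|)).circleAverage
  rw [Real.circleAverage_def] at h1
  have h2 : (2 * Real.pi) ≠ 0 := by positivity
  rw [← h1]
  simp only [circleMap, ofReal_one, one_mul, zero_add, Circle.coe_exp, Complex.real_smul]
  rw [← mul_assoc, ← Complex.ofReal_mul, mul_inv_cancel₀ h2]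
  simp

/-- The mean value property of an entire function with respect to a Gaussian measure on `ℂ^d`. -/
theorem integral_mul_gaussian_eq {d : ℕ} {a : ℝ} {H : (Fin d → ℂ) → ℂ} (hH : Differentiable ℂ H)
    (hint : Integrable (fun w => H w * (Real.exp (-a * ∑ j, ‖w j‖ ^ 2) : ℂ))) :
    ∫ w, H w * (Real.exp (-a * ∑ j, ‖w j‖ ^ 2) : ℂ) =
      H 0 * ((∫ w : Fin d → ℂ, Real.exp (-a * ∑ j, ‖w j‖ ^ 2) : ℝ) : ℂ) := by
  set g : (Fin d → ℂ) → ℂ := fun w => (Real.exp (-a * ∑ j, ‖w j‖ ^ 2) : ℂ) with hg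
  have hrot : ∀ (c : Circle) (w : Fin d → ℂ), g ((c : ℂ) • w) = g w := by
    intro c w; simp only [hg, Pi.smul_apply, norm_smul, Circle.norm_coe, one_mul]
  have hcomp : ∀ c : Circle, (fun w => H ((c : ℂ) • w) * g w) =
      (fun w => H w * g w) ∘ (fun w => (c : ℂ) • w) := by
    intro c; funext w; simp [hrot]
  have hcont : Continuous g := by fun_prop
  have hI : ∀ c : Circle, Integrable (fun w => H ((c : ℂ) • w) * g w) := by
    intro c
    rw [hcomp]
    exact ((measurePreserving_circle_smul c).integrable_comp_emb
      (measurableEmbedding_circle_smul c)).2 hint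
  have hE : ∀ c : Circle, ∫ w, H ((c : ℂ) • w) * g w = ∫ w, H w * g w := by
    intro c
    have := (measurePreserving_circle_smul c).integral_comp (measurableEmbedding_circle_smul c)
      (fun w => H w * g w)
    simpa only [hrot] using this
  have hN : ∀ c : Circle, ∫ w, ‖H ((c : ℂ) • w) * g w‖ = ∫ w, ‖H w * g w‖ := by
    intro c
    have := (measurePreserving_circle_smul c).integral_comp (measurableEmbedding_circle_smul c)
      (fun w => ‖H w * g w‖)
    simpa only [hrot] using this
  have hprod : Integrable (Function.uncurry fun (θ : ℝ) (w : Fin d → ℂ) =>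
      H ((Circle.exp θ : ℂ) • w) * g w)
      ((volume.restrict (Set.uIoc 0 (2 * Real.pi))).prod volume) := by
    have hc : Continuous (Function.uncurry fun (θ : ℝ) (w : Fin d → ℂ) =>
        H ((Circle.exp θ : ℂ) • w) * g w) := by
      have := hH.continuous
      have h2 : Continuous fun θ : ℝ => (Circle.exp θ : ℂ) :=
        continuous_subtype_val.comp Circle.exp.continuous
      simp only [Function.uncurry_def]
      fun_prop
    refine (integrable_prod_iff hc.aestronglyMeasurable).2
      ⟨ae_of_all _ fun θ => hI (Circle.exp θ), ?_⟩
    simp only [Function.uncurry, hN]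
    rw [Set.uIoc_of_le (by positivity)]
    exact integrable_const _
  -- Rotating `H` leaves the integral unchanged, so averaging over the angle is harmless; done
  -- inside the integral, it replaces `H` by `H 0`.
  have hswap := intervalIntegral_integral_swap hprod
  simp only [hE] at hswap
  have hin : ∀ w, ∫ θ in (0 : ℝ)..2 * Real.pi, H ((Circle.exp θ : ℂ) • w) * g w =
      (2 * Real.pi : ℝ) * (H 0 * g w) := by
    intro w
    rw [intervalIntegral.integral_mul_const,
      intervalIntegral_circle_eq (h := fun t => H (t • w)) (by fun_prop)]
    simp [mul_assoc]
  simp only [hin] at hswap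
  rw [intervalIntegral.integral_const, integral_const_mul, sub_zero, Complex.real_smul] at hswap
  have h2 : ((2 * Real.pi : ℝ) : ℂ) ≠ 0 := by
    rw [Complex.ofReal_ne_zero]; positivity
  rw [mul_left_cancel₀ h2 hswap, integral_const_mul, hg, integral_complex_ofReal]

/-- Recentring the Gaussian at `z` costs a factor holomorphic in `w`; this reduces the reproducing
formula at `z` to the mean value property at the origin. -/
theorem exp_neg_mul_norm_sub_sq_eq {d : ℕ} (a : ℝ) (z w : Fin d → ℂ) :
    cexp (-a * ∑ j, conj (z j) * (w j - z j)) * (Real.exp (-a * ∑ j, ‖w j - z j‖ ^ 2) : ℂ) =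
      cexp (a * ∑ j, z j * conj (w j)) * (Real.exp (-a * ∑ j, ‖w j‖ ^ 2) : ℂ) := by
  rw [Complex.ofReal_exp, Complex.ofReal_exp, ← Complex.exp_add, ← Complex.exp_add]
  congr 1
  push_cast
  simp only [← Complex.conj_mul', Finset.mul_sum, ← Finset.sum_add_distrib, map_sub]
  exact Finset.sum_congr rfl fun j _ => by ring

/-- The exponential `e^{a z·w̄}` is absorbed by half of the Gaussian weight. -/
theorem norm_cexp_mul_exp_le {d : ℕ} {a : ℝ} (ha : 0 < a) (z w : Fin d → ℂ) :
    ‖cexp (a * ∑ j, z j * conj (w j))‖ * Real.exp (-(a / 2) * ∑ j, ‖w j‖ ^ 2) ≤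
      Real.exp (a / 2 * ∑ j, ‖z j‖ ^ 2) := by
  rw [Complex.norm_exp, ← Real.exp_add, Real.exp_le_exp]
  simp only [Complex.re_ofReal_mul, Complex.re_sum, Finset.mul_sum, ← Finset.sum_add_distrib]
  refine Finset.sum_le_sum fun j _ => ?_
  -- Expanding this square is the whole estimate.
  have h : 0 ≤ a / 2 * ‖z j - w j‖ ^ 2 := by positivity
  simp only [← Complex.normSq_eq_norm_sq, Complex.normSq_apply, Complex.mul_re, Complex.conj_re,
    Complex.conj_im, Complex.sub_re, Complex.sub_im] at h ⊢
  linarith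

theorem integrable_mul_cexp_mul_gaussian {d : ℕ} {a : ℝ} (ha : 0 < a) {G : (Fin d → ℂ) → ℂ}
    (hG : Continuous G)
    (hint : Integrable (fun w => ‖G w‖ * Real.exp (-(a / 2) * ∑ j, ‖w j‖ ^ 2)))
    (z : Fin d → ℂ) :
    Integrable (fun w => G w *
      (cexp (a * ∑ j, z j * conj (w j)) * (Real.exp (-a * ∑ j, ‖w j‖ ^ 2) : ℂ))) := by
  refine (hint.mul_const (Real.exp (a / 2 * ∑ j, ‖z j‖ ^ 2))).mono'
    (Continuous.aestronglyMeasurable (by fun_prop)) (ae_of_all _ fun w => ?_)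
  have h := norm_cexp_mul_exp_le ha z w
  have hs : Real.exp (-a * ∑ j, ‖w j‖ ^ 2) =
      Real.exp (-(a / 2) * ∑ j, ‖w j‖ ^ 2) * Real.exp (-(a / 2) * ∑ j, ‖w j‖ ^ 2) := by
    rw [← Real.exp_add]; congr 1; ring
  rw [norm_mul, norm_mul, Complex.norm_real, Real.norm_eq_abs, Real.abs_exp, hs, mul_assoc]
  refine mul_le_mul_of_nonneg_left ?_ (norm_nonneg _)
  rw [← mul_assoc, mul_comm]
  exact mul_le_mul_of_nonneg_left h (Real.exp_pos _).le

/-- The reproducing formula of the Bargmann–Fock space, for entire functions that are integrable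
against the square root of the Gaussian weight. -/
theorem reproducing_formula {d : ℕ} {a : ℝ} (ha : 0 < a) {G : (Fin d → ℂ) → ℂ}
    (hG : Differentiable ℂ G)
    (hint : Integrable (fun w => ‖G w‖ * Real.exp (-(a / 2) * ∑ j, ‖w j‖ ^ 2)))
    (z : Fin d → ℂ) :
    ∫ w, G w * (cexp (a * ∑ j, z j * conj (w j)) * (Real.exp (-a * ∑ j, ‖w j‖ ^ 2) : ℂ)) =
      G z * ((∫ w : Fin d → ℂ, Real.exp (-a * ∑ j, ‖w j‖ ^ 2) : ℝ) : ℂ) := by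
  set H : (Fin d → ℂ) → ℂ := fun w => G (w + z) * cexp (-a * ∑ j, conj (z j) * w j) with hH
  have hHd : Differentiable ℂ H := by fun_prop
  have hshift : (fun w => G w *
      (cexp (a * ∑ j, z j * conj (w j)) * (Real.exp (-a * ∑ j, ‖w j‖ ^ 2) : ℂ))) =
      fun w => (fun u => H u * (Real.exp (-a * ∑ j, ‖u j‖ ^ 2) : ℂ)) (w - z) := by
    funext w
    simp only [hH, sub_add_cancel, Pi.sub_apply]
    rw [mul_assoc, exp_neg_mul_norm_sub_sq_eq]
  have hI := integrable_mul_cexp_mul_gaussian ha hG.continuous hint z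
  rw [hshift] at hI ⊢
  rw [integral_sub_right_eq_self (fun u => H u * (Real.exp (-a * ∑ j, ‖u j‖ ^ 2) : ℂ)) z]
  have hI' : Integrable (fun u => H u * (Real.exp (-a * ∑ j, ‖u j‖ ^ 2) : ℂ)) := by
    simpa using hI.comp_add_right z
  rw [integral_mul_gaussian_eq hHd hI']
  simp [hH]

/-! ### Gaussian integrals on `ℝ^d` and the measure `ρ dx` -/

theorem integrable_exp_neg_mul_sum_sq_add {d : ℕ} {b : ℝ} (hb : 0 < b) (c : Fin d → ℝ) :
    Integrable (fun x : Fin d → ℝ => Real.exp (-b * ∑ j, x j ^ 2 + ∑ j, c j * x j)) := by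
  refine (GaussianFourier.integrable_cexp_neg_mul_sum_add (b := b) (by simpa using hb)
    (fun j => (c j : ℂ))).norm.congr (ae_of_all _ fun x => ?_)
  simp only [Complex.norm_exp]
  norm_cast

theorem integral_exp_neg_mul_sum_sq_add {d : ℕ} {b : ℝ} (hb : 0 < b) (c : Fin d → ℝ) :
    ∫ x : Fin d → ℝ, Real.exp (-b * ∑ j, x j ^ 2 + ∑ j, c j * x j) =
      (Real.pi / b) ^ ((d : ℝ) / 2) * Real.exp ((∑ j, c j ^ 2) / (4 * b)) := by
  have h := GaussianFourier.integral_cexp_neg_mul_sum_add (b := b) (by simpa using hb)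
    (fun j => (c j : ℂ))
  rw [← Complex.ofReal_inj, ← integral_complex_ofReal]
  convert h using 1
  · simp
  · rw [Complex.ofReal_mul, Complex.ofReal_cpow (by positivity)]
    simp

theorem lintegral_exp_neg_mul_sum_sq_add {d : ℕ} {b : ℝ} (hb : 0 < b) (c : Fin d → ℝ) :
    ∫⁻ x : Fin d → ℝ, ENNReal.ofReal (Real.exp (-b * ∑ j, x j ^ 2 + ∑ j, c j * x j)) =
      ENNReal.ofReal ((Real.pi / b) ^ ((d : ℝ) / 2) * Real.exp ((∑ j, c j ^ 2) / (4 * b))) := by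
  rw [← integral_exp_neg_mul_sum_sq_add hb, ofReal_integral_eq_lintegral_ofReal
    (integrable_exp_neg_mul_sum_sq_add hb c) (ae_of_all _ fun _ => (Real.exp_pos _).le)]

theorem continuous_rho (d : ℕ) : Continuous (rho : (Fin d → ℝ) → ℝ) := by
  unfold rho; fun_prop

theorem rho_pos {d : ℕ} (x : Fin d → ℝ) : 0 < rho x := by
  unfold rho; positivity

theorem integrable_rho (d : ℕ) : Integrable (rho : (Fin d → ℝ) → ℝ) := by
  have h := (integrable_exp_neg_mul_sum_sq_add (d := d) (b := 1 / 2) (by norm_num) 0).const_mul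
    ((2 * Real.pi) ^ (-(d : ℝ) / 2))
  refine h.congr (ae_of_all _ fun x => ?_)
  simp only [rho, Pi.zero_apply, zero_mul, Finset.sum_const_zero, add_zero]
  congr 2
  ring

instance isFiniteMeasure_gaussianMeasure (d : ℕ) : IsFiniteMeasure (gaussianMeasure d) :=
  isFiniteMeasure_withDensity_ofReal (integrable_rho d).2

theorem gaussianMeasure_absolutelyContinuous (d : ℕ) : gaussianMeasure d ≪ volume :=
  withDensity_absolutelyContinuous _ _

theorem absolutelyContinuous_gaussianMeasure (d : ℕ) : volume ≪ gaussianMeasure d :=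
  withDensity_absolutelyContinuous' (continuous_rho d).measurable.ennreal_ofReal.aemeasurable
    (ae_of_all _ fun x => by simpa using rho_pos x)

theorem integrable_gaussianMeasure_iff {d : ℕ} {f : (Fin d → ℝ) → ℂ} :
    Integrable f (gaussianMeasure d) ↔ Integrable (fun x => (rho x : ℂ) * f x) := by
  unfold gaussianMeasure
  rw [integrable_withDensity_iff_integrable_smul₀'
    (continuous_rho d).measurable.ennreal_ofReal.aemeasurable (ae_of_all _ fun x => by simp)]
  simp only [ENNReal.toReal_ofReal (rho_pos _).le, Complex.real_smul]

/-- The kernel of the transform factors through the Gaussian density. -/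
theorem rhoC_sub_eq {d : ℕ} (z : Fin d → ℂ) (x : Fin d → ℝ) :
    rhoC (fun j => z j - (x j : ℂ)) =
      rho x * cexp (∑ j, z j * x j - (∑ j, z j ^ 2) / 2) := by
  simp only [rhoC, rho, Complex.ofReal_mul, mul_assoc, Complex.ofReal_exp, ← Complex.exp_add]
  congr 2
  push_cast
  simp only [Finset.sum_div, ← Finset.sum_neg_distrib, ← Finset.sum_add_distrib,
    ← Finset.sum_sub_distrib]
  exact Finset.sum_congr rfl fun j _ => by ring

/-! ### Injectivity of the transform -/

section CharacteristicFunction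

variable {E : Type*} [NormedAddCommGroup E] [NormedSpace ℝ E]
  [MeasurableSpace E] [BorelSpace E] {μ : Measure E}

theorem integrable_mul_cexp_dual {h : E → ℂ} (hh : Integrable h μ) (L : StrongDual ℝ E) :
    Integrable (fun x => h x * cexp (L x * I)) μ := by
  refine hh.mul_bdd (c := 1) (Continuous.aestronglyMeasurable (by fun_prop))
    (ae_of_all _ fun x => ?_)
  rw [Complex.norm_exp_ofReal_mul_I]

variable [CompleteSpace E] [SecondCountableTopology E]

/-- A real integrable function whose Fourier transform vanishes is zero almost everywhere. -/
theorem ae_eq_zero_of_integral_mul_cexp_dual_eq_zero_real {h : E → ℝ} (hh : Integrable h μ)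
    (h0 : ∀ L : StrongDual ℝ E, ∫ x, (h x : ℂ) * cexp (L x * I) ∂μ = 0) :
    h =ᵐ[μ] 0 := by
  have hfin : ∀ {k : E → ℝ}, Integrable k μ →
      IsFiniteMeasure (μ.withDensity fun x => ENNReal.ofReal (k x)) :=
    fun hk => isFiniteMeasure_withDensity_ofReal hk.2
  have hchar : ∀ {k : E → ℝ}, Integrable k μ → ∀ L : StrongDual ℝ E,
      charFunDual (μ.withDensity fun x => ENNReal.ofReal (k x)) L =
        ∫ x, ((max (k x) 0 : ℝ) : ℂ) * cexp (L x * I) ∂μ := by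
    intro k hk L
    rw [charFunDual_apply, integral_withDensity_eq_integral_toReal_smul₀
      hk.aemeasurable.ennreal_ofReal (ae_of_all _ fun x => by simp)]
    simp only [ENNReal.toReal_ofReal', Complex.real_smul]
  have := hfin hh
  have := hfin hh.neg
  -- The positive and negative parts of `h` are densities of finite measures with the same
  -- characteristic function.
  have heq : (μ.withDensity fun x => ENNReal.ofReal (h x)) =
      μ.withDensity fun x => ENNReal.ofReal ((-h) x) := by
    apply Measure.ext_of_charFunDual
    funext L
    have hp : ∀ {k : E → ℝ}, Integrable k μ →
        Integrable (fun x => ((max (k x) 0 : ℝ) : ℂ) * cexp (L x * I)) μ :=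
      fun hk => integrable_mul_cexp_dual hk.pos_part.ofReal L
    rw [hchar hh, hchar hh.neg, ← sub_eq_zero, ← integral_sub (hp hh) (hp hh.neg), ← h0 L]
    refine integral_congr_ae (ae_of_all _ fun x => ?_)
    simp only [Pi.neg_apply, ← sub_mul, ← Complex.ofReal_sub]
    rw [max_zero_sub_max_neg_zero_eq_self]
  have hae := (withDensity_eq_iff hh.aemeasurable.ennreal_ofReal
    hh.neg.aemeasurable.ennreal_ofReal (by
      have := measure_lt_top (μ.withDensity fun x => ENNReal.ofReal (h x)) Set.univ
      rw [withDensity_apply _ MeasurableSet.univ, Measure.restrict_univ] at this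
      exact this.ne)).1 heq
  filter_upwards [hae] with x hx
  have := congrArg ENNReal.toReal hx
  simp only [ENNReal.toReal_ofReal', Pi.neg_apply] at this
  have h2 := max_zero_sub_max_neg_zero_eq_self (h x)
  rw [Pi.zero_apply, ← h2, this, sub_self]

/-- An integrable function whose Fourier transform vanishes is zero almost everywhere. -/
theorem ae_eq_zero_of_integral_mul_cexp_dual_eq_zero {h : E → ℂ} (hh : Integrable h μ)
    (h0 : ∀ L : StrongDual ℝ E, ∫ x, h x * cexp (L x * I) ∂μ = 0) :
    h =ᵐ[μ] 0 := by
  have hconj : ∀ L : StrongDual ℝ E, ∫ x, conj (h x) * cexp (L x * I) ∂μ = 0 := by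
    intro L
    have h1 : ∀ x, conj (h x) * cexp (L x * I) = conj (h x * cexp ((-L) x * I)) := by
      intro x
      simp [← Complex.exp_conj]
    simp only [h1]
    rw [integral_conj, h0, map_zero]
  have hci : Integrable (fun x => conj (h x)) μ :=
    (Complex.conjLIE : ℂ ≃ₗᵢ[ℝ] ℂ).integrable_comp_iff.2 hh
  have hre : (fun x => (h x).re) =ᵐ[μ] 0 := by
    refine ae_eq_zero_of_integral_mul_cexp_dual_eq_zero_real hh.re fun L => ?_
    have h1 : ∀ x, ((h x).re : ℂ) * cexp (L x * I) =
        2⁻¹ * (h x * cexp (L x * I) + conj (h x) * cexp (L x * I)) := by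
      intro x; rw [Complex.re_eq_add_conj]; ring
    simp only [h1]
    rw [integral_const_mul, integral_add (integrable_mul_cexp_dual hh L)
      (integrable_mul_cexp_dual hci L), h0, hconj]
    simp
  have him : (fun x => (h x).im) =ᵐ[μ] 0 := by
    refine ae_eq_zero_of_integral_mul_cexp_dual_eq_zero_real hh.im fun L => ?_
    have h1 : ∀ x, ((h x).im : ℂ) * cexp (L x * I) =
        (2 * I)⁻¹ * (h x * cexp (L x * I) - conj (h x) * cexp (L x * I)) := by
      intro x; rw [Complex.im_eq_sub_conj]; ring
    simp only [h1]
    rw [integral_const_mul, integral_sub (integrable_mul_cexp_dual hh L)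
      (integrable_mul_cexp_dual hci L), h0, hconj]
    simp
  filter_upwards [hre, him] with x h1 h2
  exact Complex.ext h1 h2

end CharacteristicFunction

/-- The transform determines a function in `L¹(ℝ^d, ρ)` almost everywhere. -/
theorem ae_eq_of_transform_eq {d : ℕ} {f g : (Fin d → ℝ) → ℂ}
    (hf : Integrable f (gaussianMeasure d)) (hg : Integrable g (gaussianMeasure d))
    (h : transform f = transform g) : f =ᵐ[gaussianMeasure d] g := by
  rw [integrable_gaussianMeasure_iff] at hf hg
  have h0 : ∀ L : StrongDual ℝ (Fin d → ℝ),
      ∫ x, ((rho x : ℂ) * f x - (rho x : ℂ) * g x) * cexp (L x * I) = 0 := by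
    intro L
    -- The functional `L` is pairing with `y`, so its Fourier integral is read off from the
    -- transform at `z = iy`.
    set y : Fin d → ℝ := fun j => L (Pi.single j 1) with hy
    have hL : ∀ x, (L x : ℂ) * I = ∑ j, (y j * I) * x j := by
      intro x
      have h1 : L x = ∑ j, x j * y j := by
        conv_lhs => rw [pi_eq_sum_univ' x, map_sum]
        simp [hy]
      rw [h1]
      push_cast
      rw [Finset.sum_mul]
      exact Finset.sum_congr rfl fun j _ => by ring
    have hk : ∀ k : (Fin d → ℝ) → ℂ, transform k (fun j => y j * I) =
        cexp (-(∑ j, (y j * I) ^ 2) / 2) * ∫ x, (rho x : ℂ) * k x * cexp (L x * I) := by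
      intro k
      rw [transform, ← integral_const_mul]
      refine integral_congr_ae (ae_of_all _ fun x => ?_)
      simp only [rhoC_sub_eq]
      rw [hL, sub_eq_add_neg, Complex.exp_add, neg_div]
      ring
    have h2 := congrFun h (fun j => y j * I)
    rw [hk, hk] at h2
    have h3 := mul_left_cancel₀ (Complex.exp_ne_zero _) h2
    simp only [sub_mul]
    rw [integral_sub (integrable_mul_cexp_dual hf L) (integrable_mul_cexp_dual hg L), h3, sub_self]
  have hae := ae_eq_zero_of_integral_mul_cexp_dual_eq_zero (hf.sub hg) h0
  refine (gaussianMeasure_absolutelyContinuous d).ae_le ?_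
  filter_upwards [hae] with x hx
  have hr : (rho x : ℂ) ≠ 0 := Complex.ofReal_ne_zero.2 (rho_pos x).ne'
  exact mul_left_cancel₀ hr (sub_eq_zero.1 hx)

/-! ### Minkowski's inequality -/

/-- A form of Minkowski's integral inequality: superposing functions that are uniformly bounded in
`L^p` with an integrable weight gives a function in `L^p`. -/
theorem lintegral_rpow_lintegral_mul_lt_top {X W : Type*} [MeasurableSpace X] [MeasurableSpace W]
    {γ : Measure X} {μ : Measure W} [SFinite γ] [SFinite μ] {p : ℝ} (hp : 1 < p)
    {φ : X → W → ENNReal} (hφ : Measurable (Function.uncurry φ))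
    {g : W → ENNReal} (hg : Measurable g) (hgi : ∫⁻ w, g w ∂μ ≠ ⊤)
    {C : ENNReal} (hC : C ≠ ⊤) (hbound : ∀ w, ∫⁻ x, φ x w ^ p ∂γ ≤ C) :
    ∫⁻ x, (∫⁻ w, φ x w * g w ∂μ) ^ p ∂γ < ⊤ := by
  -- With `g` absorbed into a finite measure, Hölder against the constant `1` bounds the inner
  -- integral, and Tonelli brings in the uniform bound.
  set ν := μ.withDensity g with hν
  have hνu : ν Set.univ ≠ ⊤ := by
    rwa [hν, withDensity_apply _ MeasurableSet.univ, Measure.restrict_univ]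
  have hpq := Real.HolderConjugate.conjExponent hp
  set q := p.conjExponent
  have hp0 : 0 < p := by linarith
  have hsec : ∀ x, Measurable (φ x) := fun x => hφ.of_uncurry_left
  have hhol : ∀ x, (∫⁻ w, φ x w * g w ∂μ) ^ p ≤
      (∫⁻ w, φ x w ^ p ∂ν) * ((ν Set.univ) ^ (1 / q)) ^ p := by
    intro x
    have h1 : ∫⁻ w, φ x w * g w ∂μ = ∫⁻ w, φ x w ∂ν := by
      rw [hν, lintegral_withDensity_eq_lintegral_mul _ hg (hsec x)]
      simp only [Pi.mul_apply, mul_comm]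
    have h2 := ENNReal.lintegral_mul_le_Lp_mul_Lq ν hpq (hsec x).aemeasurable
      (aemeasurable_const (b := (1 : ENNReal)))
    simp only [Pi.mul_apply, mul_one, ENNReal.one_rpow, lintegral_one] at h2
    rw [h1]
    refine (ENNReal.rpow_le_rpow h2 hp0.le).trans_eq ?_
    rw [ENNReal.mul_rpow_of_nonneg _ _ hp0.le, ← ENNReal.rpow_mul, one_div_mul_cancel hp0.ne',
      ENNReal.rpow_one]
  refine (lintegral_mono hhol).trans_lt ?_
  rw [lintegral_mul_const' _ _ (by
    refine ENNReal.rpow_ne_top_of_nonneg hp0.le (ENNReal.rpow_ne_top_of_nonneg ?_ hνu)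
    exact (one_div_nonneg.2 hpq.symm.nonneg))]
  refine ENNReal.mul_lt_top ?_ (lt_top_iff_ne_top.2
    (ENNReal.rpow_ne_top_of_nonneg hp0.le (ENNReal.rpow_ne_top_of_nonneg
      (one_div_nonneg.2 hpq.symm.nonneg) hνu)))
  rw [lintegral_lintegral_swap (hφ.pow_const p).aemeasurable]
  refine (lintegral_mono hbound).trans_lt ?_
  rw [lintegral_const]
  exact ENNReal.mul_lt_top (lt_top_iff_ne_top.2 hC) (lt_top_iff_ne_top.2 hνu)

/-! ### Coherent states -/

/-- The Gaussian wave packets on `ℝ^d` whose transforms are the reproducing kernels of the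
Bargmann–Fock space of weight `a`, up to a Gaussian factor. -/
def coherent {d : ℕ} (a : ℝ) (w : Fin d → ℂ) (x : Fin d → ℝ) : ℂ :=
  cexp (-((a⁻¹ - 1) / 2) * ∑ j, (x j : ℂ) ^ 2 + ∑ j, conj (w j) * x j -
    a / 2 * ∑ j, conj (w j) ^ 2)

theorem continuous_coherent {d : ℕ} (a : ℝ) :
    Continuous (fun q : (Fin d → ℝ) × (Fin d → ℂ) => coherent a q.2 q.1) := by
  unfold coherent; fun_prop

theorem norm_coherent {d : ℕ} (a : ℝ) (w : Fin d → ℂ) (x : Fin d → ℝ) :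
    ‖coherent a w x‖ = Real.exp (-((a⁻¹ - 1) / 2) * ∑ j, x j ^ 2 + ∑ j, (w j).re * x j -
      a / 2 * ∑ j, ((w j).re ^ 2 - (w j).im ^ 2)) := by
  rw [coherent, Complex.norm_exp]
  congr 1
  have h1 : (-((a⁻¹ - 1) / 2) * ∑ j, (x j : ℂ) ^ 2 : ℂ) =
      ((-((a⁻¹ - 1) / 2) * ∑ j, x j ^ 2 : ℝ) : ℂ) := by push_cast; rfl
  have h2 : ((a : ℂ) / 2) = ((a / 2 : ℝ) : ℂ) := by push_cast; rfl
  rw [h1, h2, Complex.sub_re, Complex.add_re, Complex.ofReal_re, Complex.re_ofReal_mul,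
    Complex.re_sum, Complex.re_sum]
  simp [pow_two]

/-- The coefficient `(a⁻¹ - 1)/2` joins the `1/2` of the kernel to give `1/(2a)`. Integration in `x`
then produces `e^{a(z + w̄)²/2}`, whose `w̄²` part the last term of `coherent` cancels. -/
theorem rhoC_sub_mul_coherent {d : ℕ} (a : ℝ) (z w : Fin d → ℂ) (x : Fin d → ℝ) :
    rhoC (fun j => z j - (x j : ℂ)) * coherent a w x =
      ((((2 * Real.pi) ^ (-(d : ℝ) / 2) : ℝ) : ℂ) *
        cexp (-(∑ j, z j ^ 2) / 2 - a / 2 * ∑ j, conj (w j) ^ 2)) *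
      cexp (-((2 * a)⁻¹ : ℝ) * ∑ j, (x j : ℂ) ^ 2 + ∑ j, (z j + conj (w j)) * x j) := by
  rw [rhoC, coherent, mul_assoc, mul_assoc, ← Complex.exp_add, ← Complex.exp_add]
  congr 2
  have h : ∑ j, (z j - (x j : ℂ)) ^ 2 =
      ∑ j, z j ^ 2 - 2 * ∑ j, z j * x j + ∑ j, (x j : ℂ) ^ 2 := by
    simp only [Finset.mul_sum, ← Finset.sum_add_distrib, ← Finset.sum_sub_distrib]
    exact Finset.sum_congr rfl fun j _ => by ring
  have h2 : ∑ j, (z j + conj (w j)) * x j = ∑ j, z j * x j + ∑ j, conj (w j) * x j := by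
    simp only [add_mul, Finset.sum_add_distrib]
  rw [h, h2]
  push_cast
  rw [mul_inv]
  ring

/-- The transform of a coherent state is a reproducing kernel times a Gaussian. -/
theorem transform_coherent {d : ℕ} {a : ℝ} (ha : 0 < a) (z w : Fin d → ℂ) :
    transform (coherent a w) z =
      (((2 * Real.pi) ^ (-(d : ℝ) / 2) * (Real.pi / (2 * a)⁻¹) ^ ((d : ℝ) / 2) : ℝ) : ℂ) *
        (cexp (-((1 - a) / 2 * ∑ j, z j ^ 2)) * cexp (a * ∑ j, z j * conj (w j))) := by
  have hb : 0 < (2 * a)⁻¹ := by positivity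
  have ha' : (a : ℂ) ≠ 0 := Complex.ofReal_ne_zero.2 ha.ne'
  simp only [transform, rhoC_sub_mul_coherent]
  rw [integral_const_mul, GaussianFourier.integral_cexp_neg_mul_sum_add (by simpa using ha)]
  rw [Complex.ofReal_mul, Complex.ofReal_cpow (x := Real.pi / (2 * a)⁻¹) (by positivity)]
  have h1 : ((Real.pi / (2 * a)⁻¹ : ℝ) : ℂ) = (Real.pi : ℂ) / (((2 * a)⁻¹ : ℝ) : ℂ) := by
    push_cast; rfl
  have h2 : (((d : ℝ) / 2 : ℝ) : ℂ) = (Fintype.card (Fin d) : ℂ) / 2 := by simp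
  rw [h1, h2, mul_mul_mul_comm, ← Complex.exp_add, ← Complex.exp_add]
  congr 2
  have h : ∑ j, (z j + conj (w j)) ^ 2 =
      ∑ j, z j ^ 2 + 2 * ∑ j, z j * conj (w j) + ∑ j, conj (w j) ^ 2 := by
    simp only [Finset.mul_sum, ← Finset.sum_add_distrib]
    exact Finset.sum_congr rfl fun j _ => by ring
  rw [h]
  push_cast
  field_simp
  ring

theorem norm_rhoC_sub_mul_coherent {d : ℕ} (a : ℝ) (z w : Fin d → ℂ) (x : Fin d → ℝ) :
    ‖rhoC (fun j => z j - (x j : ℂ)) * coherent a w x‖ =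
      ((2 * Real.pi) ^ (-(d : ℝ) / 2) *
        Real.exp (-(∑ j, z j ^ 2).re / 2 - a / 2 * ∑ j, ((w j).re ^ 2 - (w j).im ^ 2))) *
      Real.exp (-(2 * a)⁻¹ * ∑ j, x j ^ 2 + ∑ j, ((z j).re + (w j).re) * x j) := by
  rw [rhoC_sub_mul_coherent, norm_mul, norm_mul, Complex.norm_exp, Complex.norm_exp,
    Complex.norm_real, Real.norm_of_nonneg (by positivity)]
  have h2 : ((a : ℂ) / 2) = ((a / 2 : ℝ) : ℂ) := by push_cast; rfl
  have h3 : (-((2 * a)⁻¹ : ℝ) * ∑ j, (x j : ℂ) ^ 2 : ℂ) =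
      ((-(2 * a)⁻¹ * ∑ j, x j ^ 2 : ℝ) : ℂ) := by push_cast; rfl
  congr 3
  · rw [h2, Complex.sub_re, Complex.re_ofReal_mul, Complex.re_sum (f := fun j => conj (w j) ^ 2)]
    simp [pow_two]
  · rw [h3, Complex.add_re, Complex.ofReal_re, Complex.re_sum]
    simp

theorem integrable_rhoC_sub_mul_coherent {d : ℕ} {a : ℝ} (ha : 0 < a) (z w : Fin d → ℂ) :
    Integrable (fun x : Fin d → ℝ => rhoC (fun j => z j - (x j : ℂ)) * coherent a w x) := by
  simp only [rhoC_sub_mul_coherent]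
  exact (GaussianFourier.integrable_cexp_neg_mul_sum_add (by simpa using ha) _).const_mul _

/-- Uniformity in `w` is what Fubini needs in `transform_synthesis`. After integration in `x` it
comes down to `(s + t)² ≤ 2s² + 2t²` for the real parts. -/
theorem integral_norm_rhoC_sub_mul_coherent_le {d : ℕ} {a : ℝ} (ha : 0 < a) (z : Fin d → ℂ) :
    ∃ C : ℝ, ∀ w : Fin d → ℂ,
      (∫ x : Fin d → ℝ, ‖rhoC (fun j => z j - (x j : ℂ)) * coherent a w x‖) *
        Real.exp (-(a / 2) * ∑ j, ‖w j‖ ^ 2) ≤ C := by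
  have hb : 0 < (2 * a)⁻¹ := by positivity
  refine ⟨(2 * Real.pi) ^ (-(d : ℝ) / 2) * (Real.pi / (2 * a)⁻¹) ^ ((d : ℝ) / 2) *
    Real.exp (-(∑ j, z j ^ 2).re / 2 + a * ∑ j, (z j).re ^ 2), fun w => ?_⟩
  simp only [norm_rhoC_sub_mul_coherent]
  rw [integral_const_mul, integral_exp_neg_mul_sum_sq_add hb, mul_mul_mul_comm, mul_assoc,
    ← Real.exp_add, ← Real.exp_add]
  refine mul_le_mul_of_nonneg_left (Real.exp_le_exp.2 ?_) (by positivity)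
  have h4 : 4 * (2 * a)⁻¹ = 2 / a := by field_simp; norm_num
  rw [h4, sub_add_eq_add_sub, sub_eq_add_neg, add_assoc, add_assoc]
  refine add_le_add_right ?_ _
  have h5 : (∑ j, ((z j).re + (w j).re) ^ 2) / (2 / a) =
      a / 2 * ∑ j, ((z j).re + (w j).re) ^ 2 := by field_simp
  rw [h5, ← neg_mul]
  simp only [Finset.mul_sum, ← Finset.sum_add_distrib]
  refine Finset.sum_le_sum fun j _ => ?_
  have h : 0 ≤ a / 2 * ((z j).re - (w j).re) ^ 2 := by positivity
  rw [← Complex.normSq_eq_norm_sq, Complex.normSq_apply]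
  linarith

theorem sum_norm_sq_eq {d : ℕ} (w : Fin d → ℂ) :
    ∑ j, ‖w j‖ ^ 2 = ∑ j, (w j).re ^ 2 + ∑ j, (w j).im ^ 2 := by
  rw [← Finset.sum_add_distrib]
  refine Finset.sum_congr rfl fun j _ => ?_
  rw [← Complex.normSq_eq_norm_sq, Complex.normSq_apply]
  ring

/-- Weighted coherent states have constant norm in `L^p(ℝ^d, ρ)` for the exponent
`a = p / (2 (p - 1))`. -/
theorem lintegral_norm_coherent_rpow {d : ℕ} {p : ℝ} (hp : 1 < p) (w : Fin d → ℂ) :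
    ∫⁻ x, ENNReal.ofReal (‖coherent (p / (2 * (p - 1))) w x‖ *
        Real.exp (-(p / (2 * (p - 1)) / 2) * ∑ j, ‖w j‖ ^ 2)) ^ p ∂gaussianMeasure d =
      ENNReal.ofReal
        ((2 * Real.pi) ^ (-(d : ℝ) / 2) * (Real.pi / ((p - 1) / 2)) ^ ((d : ℝ) / 2)) := by
  have hp1 : 0 < p - 1 := by linarith
  have hp0 : p ≠ 0 := by linarith
  set a := p / (2 * (p - 1)) with ha
  have hb : 0 < (p - 1) / 2 := by positivity
  have hmeas : Measurable fun x : Fin d → ℝ => ENNReal.ofReal (‖coherent a w x‖ *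
      Real.exp (-(a / 2) * ∑ j, ‖w j‖ ^ 2)) ^ p := by
    have : Continuous (coherent a w) := by unfold coherent; fun_prop
    fun_prop
  rw [gaussianMeasure, lintegral_withDensity_eq_lintegral_mul _
    (continuous_rho d).measurable.ennreal_ofReal hmeas]
  have hpt : ∀ x : Fin d → ℝ, ENNReal.ofReal (rho x) *
      ENNReal.ofReal (‖coherent a w x‖ * Real.exp (-(a / 2) * ∑ j, ‖w j‖ ^ 2)) ^ p =
      ENNReal.ofReal ((2 * Real.pi) ^ (-(d : ℝ) / 2) *
        Real.exp (-(p * a) * ∑ j, (w j).re ^ 2)) *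
      ENNReal.ofReal (Real.exp (-((p - 1) / 2) * ∑ j, x j ^ 2 + ∑ j, (p * (w j).re) * x j)) := by
    intro x
    have hai : a⁻¹ = 2 * (p - 1) / p := by rw [ha, inv_div]
    rw [ENNReal.ofReal_rpow_of_nonneg (by positivity) (by linarith),
      ← ENNReal.ofReal_mul (rho_pos x).le, ← ENNReal.ofReal_mul (by positivity)]
    congr 1
    rw [norm_coherent, ← Real.exp_add, ← Real.exp_mul, rho, mul_assoc, mul_assoc, ← Real.exp_add,
      ← Real.exp_add]
    congr 2
    rw [sum_norm_sq_eq, Finset.sum_sub_distrib, hai]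
    simp only [mul_assoc, ← Finset.mul_sum]
    field_simp
    ring
  simp only [Pi.mul_apply, hpt]
  rw [lintegral_const_mul' _ _ ENNReal.ofReal_ne_top, lintegral_exp_neg_mul_sum_sq_add hb,
    ← ENNReal.ofReal_mul (by positivity), mul_mul_mul_comm, ← Real.exp_add]
  congr 1
  -- The exponent left over is `(p²/(2(p-1)) - p a) ∑ (Re w_j)²`, which vanishes precisely for this
  -- `a`.
  convert mul_one _ using 2
  rw [Real.exp_eq_one_iff]
  simp only [mul_pow, ← Finset.mul_sum]
  rw [ha]
  field_simp
  ring

/-! ### Superposition of coherent states -/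

/-- The superposition of coherent states with amplitude `G`. -/
def synthesis {d : ℕ} (a : ℝ) (G : (Fin d → ℂ) → ℂ) (x : Fin d → ℝ) : ℂ :=
  ∫ w, coherent a w x * (G w * (Real.exp (-a * ∑ j, ‖w j‖ ^ 2) : ℂ))

theorem exp_neg_mul_eq_mul_self {d : ℕ} (a : ℝ) (w : Fin d → ℂ) :
    Real.exp (-a * ∑ j, ‖w j‖ ^ 2) =
      Real.exp (-(a / 2) * ∑ j, ‖w j‖ ^ 2) * Real.exp (-(a / 2) * ∑ j, ‖w j‖ ^ 2) := by
  rw [← Real.exp_add]; congr 1; ring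

/-- Half of the Gaussian weight normalizes the coherent states in `L^p(ρ)`; the other half makes `G`
integrable, as Minkowski requires. -/
theorem memLp_synthesis {d : ℕ} {p : ℝ} (hp : 1 < p) {G : (Fin d → ℂ) → ℂ} (hG : Continuous G)
    (hint : Integrable
      (fun w => ‖G w‖ * Real.exp (-(p / (2 * (p - 1)) / 2) * ∑ j, ‖w j‖ ^ 2))) :
    MemLp (synthesis (p / (2 * (p - 1))) G) (ENNReal.ofReal p) (gaussianMeasure d) := by
  set a := p / (2 * (p - 1))
  have hp0 : 0 < p := by linarith
  have hcoh := continuous_coherent (d := d) a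
  have hcont : Continuous (Function.uncurry fun (x : Fin d → ℝ) (w : Fin d → ℂ) =>
      coherent a w x * (G w * (Real.exp (-a * ∑ j, ‖w j‖ ^ 2) : ℂ))) := by
    simp only [Function.uncurry_def]
    fun_prop
  refine ⟨(StronglyMeasurable.integral_prod_right hcont.stronglyMeasurable).aestronglyMeasurable,
    ?_⟩
  rw [eLpNorm_lt_top_iff_lintegral_rpow_enorm_lt_top (by simpa using hp0) ENNReal.ofReal_ne_top,
    ENNReal.toReal_ofReal hp0.le]
  have hφ : Measurable (Function.uncurry fun (x : Fin d → ℝ) (w : Fin d → ℂ) =>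
      ENNReal.ofReal (‖coherent a w x‖ * Real.exp (-(a / 2) * ∑ j, ‖w j‖ ^ 2))) := by
    simp only [Function.uncurry_def]
    fun_prop
  refine lt_of_le_of_lt (lintegral_mono fun x => ENNReal.rpow_le_rpow ?_ hp0.le)
    (lintegral_rpow_lintegral_mul_lt_top (γ := gaussianMeasure d) (μ := volume) hp hφ
      (g := fun w => ENNReal.ofReal (‖G w‖ * Real.exp (-(a / 2) * ∑ j, ‖w j‖ ^ 2)))
      (by fun_prop) ?_ ENNReal.ofReal_ne_top (fun w => (lintegral_norm_coherent_rpow hp w).le))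
  · refine (enorm_integral_le_lintegral_enorm _).trans_eq (lintegral_congr fun w => ?_)
    rw [← ENNReal.ofReal_mul (by positivity), ← ofReal_norm, norm_mul, norm_mul,
      Complex.norm_real, Real.norm_eq_abs, Real.abs_exp, exp_neg_mul_eq_mul_self]
    congr 1
    ring
  · rw [← ofReal_integral_eq_lintegral_ofReal hint (ae_of_all _ fun _ => by positivity)]
    exact ENNReal.ofReal_ne_top

theorem transform_synthesis {d : ℕ} {a : ℝ} (ha : 0 < a) {G : (Fin d → ℂ) → ℂ}
    (hG : Differentiable ℂ G)
    (hint : Integrable (fun w => ‖G w‖ * Real.exp (-(a / 2) * ∑ j, ‖w j‖ ^ 2)))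
    (z : Fin d → ℂ) :
    transform (synthesis a G) z =
      (((2 * Real.pi) ^ (-(d : ℝ) / 2) * (Real.pi / (2 * a)⁻¹) ^ ((d : ℝ) / 2) : ℝ) : ℂ) *
        ((∫ w : Fin d → ℂ, Real.exp (-a * ∑ j, ‖w j‖ ^ 2) : ℝ) : ℂ) *
        (cexp (-((1 - a) / 2 * ∑ j, z j ^ 2)) * G z) := by
  have hGc := hG.continuous
  have hcoh := continuous_coherent (d := d) a
  set A : (Fin d → ℂ) → ℂ := fun w => G w * (Real.exp (-a * ∑ j, ‖w j‖ ^ 2) : ℂ) with hA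
  have hAc : Continuous A := by fun_prop
  have hrc : Continuous fun x : Fin d → ℝ => rhoC (fun j => z j - (x j : ℂ)) := by
    unfold rhoC; fun_prop
  have hnorm : ∀ w, ‖A w‖ = ‖G w‖ * Real.exp (-(a / 2) * ∑ j, ‖w j‖ ^ 2) *
      Real.exp (-(a / 2) * ∑ j, ‖w j‖ ^ 2) := by
    intro w
    rw [hA, norm_mul, Complex.norm_real, Real.norm_eq_abs, Real.abs_exp, exp_neg_mul_eq_mul_self,
      mul_assoc]
  have hcont : Continuous (Function.uncurry fun (x : Fin d → ℝ) (w : Fin d → ℂ) =>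
      rhoC (fun j => z j - (x j : ℂ)) * coherent a w x * A w) :=
    ((hrc.comp continuous_fst).mul hcoh).mul (hAc.comp continuous_snd)
  have hprod : Integrable (Function.uncurry fun (x : Fin d → ℝ) (w : Fin d → ℂ) =>
      rhoC (fun j => z j - (x j : ℂ)) * coherent a w x * A w) (volume.prod volume) := by
    refine (integrable_prod_iff' hcont.aestronglyMeasurable).2
      ⟨ae_of_all _ fun w => (integrable_rhoC_sub_mul_coherent ha z w).mul_const (A w), ?_⟩
    obtain ⟨C, hC⟩ := integral_norm_rhoC_sub_mul_coherent_le ha z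
    refine (hint.mul_const C).mono' ?_ (ae_of_all _ fun w => ?_)
    · exact (StronglyMeasurable.integral_prod_right
        (f := fun (w : Fin d → ℂ) (x : Fin d → ℝ) =>
          ‖Function.uncurry (fun (x : Fin d → ℝ) (w : Fin d → ℂ) =>
            rhoC (fun j => z j - (x j : ℂ)) * coherent a w x * A w) (x, w)‖)
        ((hcont.norm.comp continuous_swap).stronglyMeasurable)).aestronglyMeasurable
    · simp only [Function.uncurry, norm_mul _ (A w)]
      rw [integral_mul_const, hnorm, Real.norm_of_nonneg (by positivity), mul_comm, mul_assoc]
      refine mul_le_mul_of_nonneg_left ?_ (by positivity)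
      rw [mul_comm]
      exact hC w
  have hswap := integral_integral_swap hprod
  have hl : transform (synthesis a G) z =
      ∫ x : Fin d → ℝ, ∫ w : Fin d → ℂ, rhoC (fun j => z j - (x j : ℂ)) * coherent a w x * A w := by
    simp only [transform, synthesis, ← integral_const_mul, mul_assoc, hA]
  have hr : ∀ w : Fin d → ℂ,
      ∫ x : Fin d → ℝ, rhoC (fun j => z j - (x j : ℂ)) * coherent a w x * A w =
      ((((2 * Real.pi) ^ (-(d : ℝ) / 2) * (Real.pi / (2 * a)⁻¹) ^ ((d : ℝ) / 2) : ℝ) : ℂ) *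
        cexp (-((1 - a) / 2 * ∑ j, z j ^ 2))) *
      (G w * (cexp (a * ∑ j, z j * conj (w j)) * (Real.exp (-a * ∑ j, ‖w j‖ ^ 2) : ℂ))) := by
    intro w
    rw [integral_mul_const]
    have := transform_coherent ha z w
    rw [transform] at this
    rw [this, hA]
    ring
  rw [hl, hswap]
  simp only [hr]
  rw [integral_const_mul, reproducing_formula ha hG hint]
  ring

/-! ### Radial weight and surjectivity -/

/-- The hypothesis on `F`, read off after the multiplication with a Gaussian that makes the weight
radial. -/
theorem norm_mul_cexp_mul_exp_eq {d : ℕ} {p : ℝ} (hp : 1 < p) (F : (Fin d → ℂ) → ℂ)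
    (w : Fin d → ℂ) :
    ‖F w * cexp ((1 - (p / (2 * (p - 1)) : ℝ)) / 2 * ∑ j, w j ^ 2)‖ *
        Real.exp (-(p / (2 * (p - 1)) / 2) * ∑ j, ‖w j‖ ^ 2) =
      ‖F w‖ * Real.exp (-(∑ j, (w j).im ^ 2) / 2) *
        Real.exp (-(∑ j, (w j).re ^ 2) / (2 * (p - 1))) := by
  have hp1 : p - 1 ≠ 0 := by linarith
  have h1 : ∀ a : ℝ, ((1 - (a : ℂ)) / 2) = (((1 - a) / 2 : ℝ) : ℂ) := by intro a; push_cast; rfl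
  rw [norm_mul, mul_assoc, mul_assoc, Complex.norm_exp, ← Real.exp_add, ← Real.exp_add, h1,
    Complex.re_ofReal_mul, Complex.re_sum]
  congr 2
  -- The imaginary parts get coefficient `-1/2` for every `a`; the real parts get `1/2 - a`, which
  -- is `-1/(2(p-1))` for this `a`.
  rw [sum_norm_sq_eq]
  simp only [pow_two, Complex.mul_re, Finset.sum_sub_distrib]
  field_simp
  ring

theorem integrable_amplitude {d : ℕ} {p : ℝ} (hp : 1 < p) {F : (Fin d → ℂ) → ℂ}
    (hF : Continuous F)
    (hint : Integrable
      (fun w : (Fin d → ℝ) × (Fin d → ℝ) =>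
        ‖F (toComplex w.1 w.2)‖ * Real.exp (-(∑ j, w.2 j ^ 2) / 2) *
          Real.exp (-(∑ j, w.1 j ^ 2) / (2 * (p - 1)))) volume) :
    Integrable (fun w : Fin d → ℂ =>
      ‖F w * cexp ((1 - (p / (2 * (p - 1)) : ℝ)) / 2 * ∑ j, w j ^ 2)‖ *
        Real.exp (-(p / (2 * (p - 1)) / 2) * ∑ j, ‖w j‖ ^ 2)) := by
  simp only [norm_mul_cexp_mul_exp_eq hp]
  rw [← (measurePreserving_toComplex d).integrable_comp
    (Continuous.aestronglyMeasurable (by fun_prop))]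
  refine hint.congr (ae_of_all _ fun w => ?_)
  simp [toComplex]

theorem transform_congr_ae {d : ℕ} {f g : (Fin d → ℝ) → ℂ} (h : f =ᵐ[gaussianMeasure d] g) :
    transform f = transform g := by
  funext z
  refine integral_congr_ae ?_
  filter_upwards [(absolutelyContinuous_gaussianMeasure d).ae_le h] with x hx
  rw [hx]

theorem transform_const_mul {d : ℕ} (c : ℂ) (f : (Fin d → ℝ) → ℂ) (z : Fin d → ℂ) :
    transform (fun x => c * f x) z = c * transform f z := by
  simp only [transform, ← integral_const_mul]
  exact integral_congr_ae (ae_of_all _ fun x => by ring)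

/-- Surjectivity of the transform onto the entire functions with the given integrability. -/
theorem exists_memLp_transform_eq {d : ℕ} {p : ℝ} (hp : 1 < p) {F : (Fin d → ℂ) → ℂ}
    (hF : Differentiable ℂ F)
    (hint : Integrable
      (fun w : (Fin d → ℝ) × (Fin d → ℝ) =>
        ‖F (toComplex w.1 w.2)‖ * Real.exp (-(∑ j, w.2 j ^ 2) / 2) *
          Real.exp (-(∑ j, w.1 j ^ 2) / (2 * (p - 1)))) volume) :
    ∃ f : (Fin d → ℝ) → ℂ, MemLp f (ENNReal.ofReal p) (gaussianMeasure d) ∧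
      transform f = F := by
  have hI := integrable_amplitude hp hF.continuous hint
  set a := p / (2 * (p - 1)) with haDef
  have hp1 : 0 < p - 1 := by linarith
  have ha : 0 < a := by positivity
  set G : (Fin d → ℂ) → ℂ := fun w => F w * cexp ((1 - (a : ℂ)) / 2 * ∑ j, w j ^ 2) with hG
  have hGd : Differentiable ℂ G := by fun_prop
  set K : ℂ :=
    (((2 * Real.pi) ^ (-(d : ℝ) / 2) * (Real.pi / (2 * a)⁻¹) ^ ((d : ℝ) / 2) : ℝ) : ℂ) *
      ((∫ w : Fin d → ℂ, Real.exp (-a * ∑ j, ‖w j‖ ^ 2) : ℝ) : ℂ) with hK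
  have hK0 : K ≠ 0 := by
    rw [hK]
    refine mul_ne_zero (Complex.ofReal_ne_zero.2 (by positivity)) (Complex.ofReal_ne_zero.2 ?_)
    exact (integral_exp_pos (integrable_exp_neg_mul_sum_norm_sq ha)).ne'
  refine ⟨fun x => K⁻¹ * synthesis a G x, (memLp_synthesis hp hGd.continuous hI).const_mul _, ?_⟩
  funext z
  rw [transform_const_mul, transform_synthesis ha hGd hI, ← hK, inv_mul_cancel_left₀ hK0, hG]
  simp only
  -- The Gaussian in the transform of the superposition is inverse to the one in `G`.
  rw [mul_left_comm, ← Complex.exp_add]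
  simp

end SegalBargmann

end

theorem mainTheorem1 (d : ℕ) (p : ℝ) (hp : 1 < p)
    (F : (Fin d → ℂ) → ℂ) (hF : Differentiable ℂ F)
    (hint : MeasureTheory.Integrable
      (fun w : (Fin d → ℝ) × (Fin d → ℝ) =>
        ‖F (SegalBargmann.toComplex w.1 w.2)‖ * Real.exp (-(∑ j, w.2 j ^ 2) / 2) *
          Real.exp (-(∑ j, w.1 j ^ 2) / (2 * (p - 1))))
      MeasureTheory.volume) :
    ∃! f : MeasureTheory.Lp ℂ (ENNReal.ofReal p) (SegalBargmann.gaussianMeasure d),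
      SegalBargmann.transform (f : (Fin d → ℝ) → ℂ) = F := by
  have hp1 : (1 : ENNReal) ≤ ENNReal.ofReal p := by
    rw [← ENNReal.ofReal_one]
    exact ENNReal.ofReal_le_ofReal hp.le
  obtain ⟨f, hf, hfF⟩ := SegalBargmann.exists_memLp_transform_eq hp hF hint
  have hcoe : SegalBargmann.transform (hf.toLp f : (Fin d → ℝ) → ℂ) = F :=
    (SegalBargmann.transform_congr_ae hf.coeFn_toLp).trans hfF
  refine ⟨hf.toLp f, hcoe, fun g hg => ?_⟩
  -- The Gaussian measure is finite, so `L^p ⊆ L¹` and injectivity on `L¹` applies.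
  exact MeasureTheory.Lp.ext (SegalBargmann.ae_eq_of_transform_eq
    ((MeasureTheory.Lp.memLp g).integrable hp1)
    ((MeasureTheory.Lp.memLp (hf.toLp f)).integrable hp1) (hg.trans hcoe.symm))
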